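/- Let $\mathit{Atm}$ (atoms) and $\mathit{Nom}$ (nominals) be disjoint countably infinite sets and $\mathit{Agt}$ a finite set (agents); $i$ ranges over $\mathit{Agt}$ and $\tau$ over $\{P,D\}$. Programs $\pi$ and formulas $\varphi$ are generated by $$\pi ::= \;\equiv_i\; \mid\; \preceq_{i,\tau}\; \mid\; \preceq_{i,\tau}^{\sim}\; \mid \pi;\pi' \mid \pi\cup\pi' \mid \pi\cap\pi' \mid -\pi \mid \varphi?\qquad \varphi ::= p \mid x \mid \neg\varphi \mid \varphi\wedge\varphi' \mid [\pi]\varphi$$ with $p\in\mathit{Atm}$, $x\in\mathit{Nom}$. The connectives $\vee,\to,\leftrightarrow$ are the usual abbreviations, $\bot$ is $p\wedge\neg p$ for a fixed atom $p$, and $\langle\pi\rangle\varphi$ is $\neg[\pi]\neg\varphi$. A multi-agent cognitive model (MCM) $M$ consists of a set $W$, preorders $\preceq_{i,P},\preceq_{i,D}$ and equivalence relations $\equiv_i$ on $W$ for $i\in\mathit{Agt}$, and a map $V:W\to 2^{\mathit{Atm}\cup\mathit{Nom}}$, such that for all $i,\tau$ and $w,v\in W$: (C1) $\preceq_{i,\tau}\,\subseteq\,\equiv_i$;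 (C2) if $w\equiv_i v$ then $w\preceq_{i,\tau}v$ or $v\preceq_{i,\tau}w$; (C3) $V(w)\cap\mathit{Nom}\ne\emptyset$; (C4) if $V(w)\cap V(v)\cap\mathit{Nom}\neq\emptyset$ then $w=v$. Truth at a world is defined by: $M,w\models p$ iff $p\in V(w)$; $M,w\models x$ iff $x\in V(w)$; $\neg,\wedge$ as usual; $M,w\models[\pi]\varphi$ iff $M,v\models\varphi$ for all $v$ with $wR_\pi v$. Here $R_{\equiv_i}$ is $\equiv_i$; $R_{\preceq_{i,\tau}}$ is $\preceq_{i,\tau}$; $R_{\preceq_{i,\tau}^\sim}$ is $\equiv_i\setminus\preceq_{i,\tau}$; $R_{\pi;\pi'}$, $R_{\pi\cup\pi'}$, $R_{\pi\cap\pi'}$, $R_{-\pi}$ are relational composition ($R_\pi$ first), union, intersection and converse; and $wR_{\varphi?}v$ iff $w=v$ and $M,w\models\varphi$. A formula is valid if it is true at every world of every MCM. The set of theorems of the logic $\mathrm{DLCA}$ is the least set of formulas that contains all instances of propositional tautologies and all instances of the schemes - $([\pi]\varphi\wedge[\pi](\varphi\to\psi))\to[\pi]\psi$; - $[\equiv_i]\varphi\to\varphi$;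 $\;[\equiv_i]\varphi\to[\equiv_i][\equiv_i]\varphi$; $\;\neg[\equiv_i]\varphi\to[\equiv_i]\neg[\equiv_i]\varphi$; - $[\preceq_{i,\tau}]\varphi\to\varphi$; $\;[\preceq_{i,\tau}]\varphi\to[\preceq_{i,\tau}][\preceq_{i,\tau}]\varphi$; $\;[\equiv_i]\varphi\to[\preceq_{i,\tau}]\varphi$; - $(\langle\equiv_i\rangle\varphi\wedge\langle\equiv_i\rangle\psi)\to(\langle\equiv_i\rangle(\varphi\wedge\langle\preceq_{i,\tau}\rangle\psi)\vee\langle\equiv_i\rangle(\psi\wedge\langle\preceq_{i,\tau}\rangle\varphi))$; - $[\pi;\pi']\varphi\leftrightarrow[\pi][\pi']\varphi$; $\;[\pi\cup\pi']\varphi\leftrightarrow([\pi]\varphi\wedge[\pi']\varphi)$; - $([\pi]\varphi\wedge[\pi']\psi)\to[\pi\cap\pi'](\varphi\wedge\psi)$; $\;(\langle\pi\rangle x\wedge\langle\pi'\rangle x)\to\langle\pi\cap\pi'\rangle x$; - $\varphi\to[\pi]\langle-\pi\rangle\varphi$; $\;\varphi\to[-\pi]\langle\pi\rangle\varphi$;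 - $([\preceq_{i,\tau}]\varphi\wedge[\preceq_{i,\tau}^\sim]\varphi)\leftrightarrow[\equiv_i]\varphi$; $\;\langle\preceq_{i,\tau}\rangle x\to[\preceq_{i,\tau}^\sim]\neg x$; - $[\varphi?]\psi\leftrightarrow(\varphi\to\psi)$; - $\langle\pi\rangle(x\wedge\varphi)\to[\pi'](x\to\varphi)$; and is closed under modus ponens, necessitation (from $\varphi$ infer $[\pi]\varphi$) and the infinitary rule Cov (from $[\pi]\neg x$ for all $x\in\mathit{Nom}$ infer $[\pi]\bot$). **Theorem.** The logic $\mathrm{DLCA}$ is sound and complete for the class of multi-agent cognitive models: a formula $\varphi$ is a theorem of $\mathrm{DLCA}$ if and only if it is valid. -/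

import Mathlib

universe u₁ u₂ u₃ u

namespace DLCA

/-- The two kinds of orderings: `P` (plausibility) and `D` (desirability). -/
inductive Attitude : Type
  | P
  | D

mutual
/-- Cognitive programs. -/
inductive Program (Atm : Type u₁) (Nom : Type u₂) (Agt : Type u₃) : Type (max u₁ u₂ u₃)
  /-- `≡_i` -/
  | know (i : Agt)
  /-- `⪯_{i,τ}` -/
  | le (i : Agt) (τ : Attitude)
  /-- the complement `⪯_{i,τ}^∼` -/
  | nle (i : Agt) (τ : Attitude)
  /-- sequential composition `π ; π'` -/
  | seq (π π' : Program Atm Nom Agt)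
  /-- nondeterministic choice `π ∪ π'` -/
  | union (π π' : Program Atm Nom Agt)
  /-- intersection `π ∩ π'` -/
  | inter (π π' : Program Atm Nom Agt)
  /-- converse `-π` -/
  | conv (π : Program Atm Nom Agt)
  /-- test `φ?` -/
  | test (φ : Formula Atm Nom Agt)

/-- Formulas of the language, over atoms `Atm`, nominals `Nom` and agents `Agt`. -/
inductive Formula (Atm : Type u₁) (Nom : Type u₂) (Agt : Type u₃) : Type (max u₁ u₂ u₃)
  | atom (p : Atm)
  | nom (x : Nom)
  | neg (φ : Formula Atm Nom Agt)
  | and (φ ψ : Formula Atm Nom Agt)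
  /-- `[π] φ` -/
  | box (π : Program Atm Nom Agt) (φ : Formula Atm Nom Agt)
end

section Abbreviations

variable {Atm : Type u₁} {Nom : Type u₂} {Agt : Type u₃}

/-- `φ ∨ ψ` -/
def Formula.or (φ ψ : Formula Atm Nom Agt) : Formula Atm Nom Agt :=
  .neg (.and (.neg φ) (.neg ψ))

/-- `φ → ψ` -/
def Formula.imp (φ ψ : Formula Atm Nom Agt) : Formula Atm Nom Agt :=
  .neg (.and φ (.neg ψ))

/-- `φ ↔ ψ` -/
def Formula.iff (φ ψ : Formula Atm Nom Agt) : Formula Atm Nom Agt :=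
  .and (.imp φ ψ) (.imp ψ φ)

/-- `⊥`, that is `p ∧ ¬ p` for a fixed atom `p`. -/
noncomputable def Formula.bot [Nonempty Atm] : Formula Atm Nom Agt :=
  .and (.atom (Classical.arbitrary Atm)) (.neg (.atom (Classical.arbitrary Atm)))

/-- `⟨π⟩ φ` -/
def Formula.dia (π : Program Atm Nom Agt) (φ : Formula Atm Nom Agt) : Formula Atm Nom Agt :=
  .neg (.box π (.neg φ))

end Abbreviations

prefix:max "∼" => Formula.neg
infixr:70 " ⋏ " => Formula.and
infixr:65 " ⋎ " => Formula.or
infixr:60 " ⇒ " => Formula.imp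
infix:55 " ⇔ " => Formula.iff
infixr:80 " ⊡ " => Formula.box
infixr:80 " ⟐ " => Formula.dia

/-! ### Semantics -/

/-- The data of a multi-agent cognitive model, without its constraints. -/
structure CogStructure (Atm : Type u₁) (Nom : Type u₂) (Agt : Type u₃) where
  World : Type u
  /-- `le i τ w v` is `w ⪯_{i,τ} v` -/
  le : Agt → Attitude → World → World → Prop
  /-- `know i w v` is `w ≡_i v` -/
  know : Agt → World → World → Prop
  /-- the valuation, with values in the subsets of the disjoint union of `Atm` and `Nom` -/
  V : World → Set (Atm ⊕ Nom)

section Semantics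

variable {Atm : Type u₁} {Nom : Type u₂} {Agt : Type u₃}

/-- The set of nominals that hold at `w`. -/
def CogStructure.VNom (M : CogStructure.{u₁, u₂, u₃, u} Atm Nom Agt) (w : M.World) : Set Nom :=
  {x | Sum.inr x ∈ M.V w}

/-- `M` is a multi-agent cognitive model. -/
structure CogStructure.IsMCM (M : CogStructure.{u₁, u₂, u₃, u} Atm Nom Agt) : Prop where
  le_preorder : ∀ i τ, IsPreorder M.World (M.le i τ)
  know_equivalence : ∀ i, Equivalence (M.know i)
  c1 : ∀ i τ w v, M.le i τ w v → M.know i w v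
  c2 : ∀ i τ w v, M.know i w v → M.le i τ w v ∨ M.le i τ v w
  c3 : ∀ w, M.VNom w ≠ ∅
  c4 : ∀ w v, M.VNom w ∩ M.VNom v ≠ ∅ → w = v

mutual
/-- The binary relation `R_π` on worlds. -/
def CogStructure.Rel (M : CogStructure.{u₁, u₂, u₃, u} Atm Nom Agt) :
    Program Atm Nom Agt → M.World → M.World → Prop
  | .know i, w, v => M.know i w v
  | .le i τ, w, v => M.le i τ w v
  | .nle i τ, w, v => M.know i w v ∧ ¬ M.le i τ w v
  | .seq π π', w, v => ∃ z, M.Rel π w z ∧ M.Rel π' z v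
  | .union π π', w, v => M.Rel π w v ∨ M.Rel π' w v
  | .inter π π', w, v => M.Rel π w v ∧ M.Rel π' w v
  | .conv π, w, v => M.Rel π v w
  | .test φ, w, v => w = v ∧ M.Sat φ w

/-- Truth of a formula at a world: `M.Sat φ w` is `M, w ⊨ φ`. -/
def CogStructure.Sat (M : CogStructure.{u₁, u₂, u₃, u} Atm Nom Agt) :
    Formula Atm Nom Agt → M.World → Prop
  | .atom p, w => Sum.inl p ∈ M.V w
  | .nom x, w => Sum.inr x ∈ M.V w
  | .neg φ, w => ¬ M.Sat φ w
  | .and φ ψ, w => M.Sat φ w ∧ M.Sat ψ w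
  | .box π φ, w => ∀ v, M.Rel π w v → M.Sat φ v
end

/-- Validity with respect to the class of multi-agent cognitive models. -/
def Valid (φ : Formula Atm Nom Agt) : Prop :=
  ∀ M : CogStructure.{u₁, u₂, u₃, u} Atm Nom Agt, M.IsMCM → ∀ w : M.World, M.Sat φ w

end Semantics

/-! ### The logic DLCA -/

section Logic

variable {Atm : Type u₁} {Nom : Type u₂} {Agt : Type u₃}

/-- `φ` is an instance of a propositional tautology: it is true under every Boolean valuation of
the formulas (nominals, atoms and boxed formulas being given arbitrary truth values). -/
def IsTautology (φ : Formula Atm Nom Agt) : Prop :=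
  ∀ v : Formula Atm Nom Agt → Prop,
    (∀ α, v (∼α) ↔ ¬ v α) → (∀ α β, v (α ⋏ β) ↔ v α ∧ v β) → v φ

/-- `Provable φ` says that `φ` is a theorem of DLCA: the least set of formulas that contains
all instances of the axiom schemes and is closed under modus ponens, necessitation and the
infinitary rule Cov. -/
inductive Provable [Nonempty Atm] : Formula Atm Nom Agt → Prop
  /-- classical propositional logic -/
  | taut (φ) : IsTautology φ → Provable φ
  | mp (φ ψ) : Provable (φ ⇒ ψ) → Provable φ → Provable ψ
  | ax_k (π φ ψ) : Provable ((π ⊡ φ ⋏ π ⊡ (φ ⇒ ψ)) ⇒ π ⊡ ψ)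
  | t_know (i φ) : Provable (.know i ⊡ φ ⇒ φ)
  | four_know (i φ) : Provable (.know i ⊡ φ ⇒ .know i ⊡ .know i ⊡ φ)
  | five_know (i φ) : Provable (∼(.know i ⊡ φ) ⇒ .know i ⊡ ∼(.know i ⊡ φ))
  | t_le (i τ φ) : Provable (.le i τ ⊡ φ ⇒ φ)
  | four_le (i τ φ) : Provable (.le i τ ⊡ φ ⇒ .le i τ ⊡ .le i τ ⊡ φ)
  | inc (i τ φ) : Provable (.know i ⊡ φ ⇒ .le i τ ⊡ φ)
  | conn (i τ φ ψ) : Provable ((.know i ⟐ φ ⋏ .know i ⟐ ψ) ⇒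
      (.know i ⟐ (φ ⋏ .le i τ ⟐ ψ) ⋎ .know i ⟐ (ψ ⋏ .le i τ ⟐ φ)))
  | red_seq (π π' φ) : Provable (.seq π π' ⊡ φ ⇔ π ⊡ π' ⊡ φ)
  | red_union (π π' φ) : Provable (.union π π' ⊡ φ ⇔ (π ⊡ φ ⋏ π' ⊡ φ))
  | add1_inter (π π' φ ψ) : Provable ((π ⊡ φ ⋏ π' ⊡ ψ) ⇒ .inter π π' ⊡ (φ ⋏ ψ))
  | add2_inter (π π' x) : Provable ((π ⟐ .nom x ⋏ π' ⟐ .nom x) ⇒ .inter π π' ⟐ .nom x)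
  | conv1 (π φ) : Provable (φ ⇒ π ⊡ .conv π ⟐ φ)
  | conv2 (π φ) : Provable (φ ⇒ .conv π ⊡ π ⟐ φ)
  | comp1 (i τ φ) : Provable ((.le i τ ⊡ φ ⋏ .nle i τ ⊡ φ) ⇔ .know i ⊡ φ)
  | comp2 (i τ x) : Provable (.le i τ ⟐ .nom x ⇒ .nle i τ ⊡ ∼(.nom x))
  | red_test (φ ψ) : Provable (.test φ ⊡ ψ ⇔ (φ ⇒ ψ))
  | most (π π' x φ) : Provable (π ⟐ (.nom x ⋏ φ) ⇒ π' ⊡ (.nom x ⇒ φ))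
  | nec (π φ) : Provable φ → Provable (π ⊡ φ)
  | cov (π) : (∀ x, Provable (π ⊡ ∼(.nom x))) → Provable (π ⊡ .bot)

end Logic

end DLCA

namespace DLCA

-- Soundness

section Soundness

variable {Atm : Type u₁} {Nom : Type u₂} {Agt : Type u₃}

namespace CogStructure

variable (M : CogStructure.{u₁, u₂, u₃, u} Atm Nom Agt)

-- Soundness is an induction on derivations. C4 justifies the axioms that mention nominals, and C3
-- justifies Cov.
--
-- For completeness, a non-theorem φ yields a maximal consistent set S that contains ¬φ and is
-- closed under Cov: for each π, either [π]⊥ or some ⟨π⟩x lies in S (`exists_isMCS`). Tests make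
-- this possible: φ → [π]ψ is interderivable with [φ?;π]ψ, so Cov also holds under a hypothesis
-- (`Provable.imp_cov`).
--
-- Only S has to be built this way. Every other world is read off from S: if ⟨π⟩x ∈ S, the formulas
-- φ with some ⟨ρ⟩(x ∧ φ) in S form a maximal consistent set, and the axiom `most` makes the choice
-- of ρ immaterial. Diamonds at these worlds have named witnesses by closure of S under Cov for the
-- program ρ;x?;π;φ? (`IsMCS.exists_witness_theoryAt`).
--
-- Since every world has a name and no name is shared, the canonical relation of π from w to a world
-- named x holds exactly when ⟨π⟩x ∈ w (`IsNamedFamily.canRel_iff`). Thus complement and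
-- intersection, which ordinary canonical models do not control, get their intended meaning, and the
-- truth lemma `IsNamedFamily.sat_iff` follows.

@[simp] theorem sat_neg (φ : Formula Atm Nom Agt) (w : M.World) :
    M.Sat (∼φ) w ↔ ¬ M.Sat φ w := by rw [Sat]

@[simp] theorem sat_and (φ ψ : Formula Atm Nom Agt) (w : M.World) :
    M.Sat (φ ⋏ ψ) w ↔ M.Sat φ w ∧ M.Sat ψ w := by rw [Sat]

@[simp] theorem sat_box (π : Program Atm Nom Agt) (φ : Formula Atm Nom Agt) (w : M.World) :
    M.Sat (π ⊡ φ) w ↔ ∀ v, M.Rel π w v → M.Sat φ v := by rw [Sat]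

@[simp] theorem sat_nom (x : Nom) (w : M.World) :
    M.Sat (.nom x) w ↔ x ∈ M.VNom w := by rw [Sat]; rfl

@[simp] theorem sat_imp (φ ψ : Formula Atm Nom Agt) (w : M.World) :
    M.Sat (φ ⇒ ψ) w ↔ (M.Sat φ w → M.Sat ψ w) := by
  simp [Formula.imp]

@[simp] theorem sat_or (φ ψ : Formula Atm Nom Agt) (w : M.World) :
    M.Sat (φ ⋎ ψ) w ↔ (M.Sat φ w ∨ M.Sat ψ w) := by
  simp only [Formula.or, sat_neg, sat_and]; tauto

@[simp] theorem sat_iff (φ ψ : Formula Atm Nom Agt) (w : M.World) :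
    M.Sat (φ ⇔ ψ) w ↔ (M.Sat φ w ↔ M.Sat ψ w) := by
  simp only [Formula.iff, sat_and, sat_imp]; tauto

@[simp] theorem sat_dia (π : Program Atm Nom Agt) (φ : Formula Atm Nom Agt) (w : M.World) :
    M.Sat (π ⟐ φ) w ↔ ∃ v, M.Rel π w v ∧ M.Sat φ v := by
  simp [Formula.dia]

variable {M} in
theorem IsMCM.eq_of_mem (hM : M.IsMCM) {w v : M.World} {x : Nom}
    (hw : x ∈ M.VNom w) (hv : x ∈ M.VNom v) : w = v :=
  hM.c4 w v (Set.nonempty_iff_ne_empty.1 ⟨x, hw, hv⟩)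

end CogStructure

open CogStructure in
/-- Every theorem of DLCA is valid. -/
theorem Provable.valid [Nonempty Atm] {φ : Formula Atm Nom Agt} (h : Provable φ) :
    Valid.{u₁, u₂, u₃, u} φ := by
  intro M hM
  induction h with
  | taut φ h => exact fun w => h (fun φ => M.Sat φ w) (by simp) (by simp)
  | mp φ ψ _ _ h₁ h₂ => exact fun w => (M.sat_imp φ ψ w).1 (h₁ w) (h₂ w)
  | ax_k π φ ψ =>
    intro w
    simp only [sat_imp, sat_and, sat_box]
    exact fun h v r => h.2 v r (h.1 v r)
  | t_know i φ =>
    intro w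
    simp only [sat_imp, sat_box, CogStructure.Rel]
    exact fun h => h w ((hM.know_equivalence i).refl w)
  | four_know i φ =>
    intro w
    simp only [sat_imp, sat_box, CogStructure.Rel]
    exact fun h v r u s => h u ((hM.know_equivalence i).trans r s)
  | five_know i φ =>
    intro w
    simp only [sat_imp, sat_neg, sat_box, CogStructure.Rel]
    exact fun h v r h' => h fun u s =>
      h' u ((hM.know_equivalence i).trans ((hM.know_equivalence i).symm r) s)
  | t_le i τ φ =>
    intro w
    simp only [sat_imp, sat_box, CogStructure.Rel]
    exact fun h => h w ((hM.le_preorder i τ).refl w)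
  | four_le i τ φ =>
    intro w
    simp only [sat_imp, sat_box, CogStructure.Rel]
    exact fun h v r u s => h u ((hM.le_preorder i τ).trans _ _ _ r s)
  | inc i τ φ =>
    intro w
    simp only [sat_imp, sat_box, CogStructure.Rel]
    exact fun h v r => h v (hM.c1 i τ w v r)
  | conn i τ φ ψ =>
    intro w
    simp only [sat_imp, sat_and, sat_or, sat_dia, CogStructure.Rel]
    rintro ⟨⟨v, r, hv⟩, u, s, hu⟩
    rcases hM.c2 i τ v u ((hM.know_equivalence i).trans ((hM.know_equivalence i).symm r) s)
      with h | h
    · exact .inl ⟨v, r, hv, u, h, hu⟩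
    · exact .inr ⟨u, s, hu, v, h, hv⟩
  | red_seq π π' φ =>
    intro w
    simp only [sat_iff, sat_box, CogStructure.Rel]
    exact ⟨fun h v r u s => h u ⟨v, r, s⟩, fun h u ⟨v, r, s⟩ => h v r u s⟩
  | red_union π π' φ =>
    intro w
    simp only [sat_iff, sat_and, sat_box, CogStructure.Rel]
    exact ⟨fun h => ⟨fun v r => h v (.inl r), fun v r => h v (.inr r)⟩,
      fun h v r => r.elim (h.1 v) (h.2 v)⟩
  | add1_inter π π' φ ψ =>
    intro w
    simp only [sat_imp, sat_and, sat_box, CogStructure.Rel]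
    exact fun h v r => ⟨h.1 v r.1, h.2 v r.2⟩
  | add2_inter π π' x =>
    intro w
    simp only [sat_imp, sat_and, sat_dia, sat_nom, CogStructure.Rel]
    rintro ⟨⟨v, r, hv⟩, u, s, hu⟩
    obtain rfl := hM.eq_of_mem hv hu
    exact ⟨v, ⟨r, s⟩, hv⟩
  | conv1 π φ =>
    intro w
    simp only [sat_imp, sat_box, sat_dia, CogStructure.Rel]
    exact fun h v r => ⟨w, r, h⟩
  | conv2 π φ =>
    intro w
    simp only [sat_imp, sat_box, sat_dia, CogStructure.Rel]
    exact fun h v r => ⟨w, r, h⟩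
  | comp1 i τ φ =>
    intro w
    simp only [sat_iff, sat_and, sat_box, CogStructure.Rel]
    exact ⟨fun h v r => by_cases (h.1 v) fun s => h.2 v ⟨r, s⟩,
      fun h => ⟨fun v r => h v (hM.c1 i τ w v r), fun v r => h v r.1⟩⟩
  | comp2 i τ x =>
    intro w
    simp only [sat_imp, sat_neg, sat_box, sat_dia, sat_nom, CogStructure.Rel]
    rintro ⟨v, r, hv⟩ u s hu
    obtain rfl := hM.eq_of_mem hv hu
    exact s.2 r
  | red_test φ ψ =>
    intro w
    simp only [sat_iff, sat_imp, sat_box, CogStructure.Rel]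
    exact ⟨fun h h' => h w ⟨rfl, h'⟩, fun h v r => r.1 ▸ h r.2⟩
  | most π π' x φ =>
    intro w
    simp only [sat_imp, sat_and, sat_box, sat_dia, sat_nom]
    rintro ⟨v, r, hv, h⟩ u s hu
    exact hM.eq_of_mem hv hu ▸ h
  | nec π φ _ h =>
    intro w
    rw [sat_box]
    exact fun v _ => h v
  | cov π _ h =>
    intro w
    rw [sat_box]
    intro v r
    -- By C3 a successor v would carry a name, which the premises of Cov exclude.
    obtain ⟨x, hx⟩ := Set.nonempty_iff_ne_empty.2 (hM.c3 v)
    have := h x w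
    simp only [sat_box, sat_neg, sat_nom] at this
    exact absurd hx (this v r)

end Soundness

-- Countability of the language, needed to enumerate formulas in Lindenbaum's lemma

section Countability

variable {Atm : Type u₁} {Nom : Type u₂} {Agt : Type u₃}

mutual
/-- A numerical code of a program, given codes of atoms, nominals and agents. -/
def Program.code (a : Atm → ℕ) (n : Nom → ℕ) (g : Agt → ℕ) : Program Atm Nom Agt → ℕ
  | .know i => Nat.pair 0 (g i)
  | .le i .P => Nat.pair 1 (g i)
  | .le i .D => Nat.pair 2 (g i)
  | .nle i .P => Nat.pair 3 (g i)
  | .nle i .D => Nat.pair 4 (g i)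
  | .seq π π' => Nat.pair 5 (Nat.pair (π.code a n g) (π'.code a n g))
  | .union π π' => Nat.pair 6 (Nat.pair (π.code a n g) (π'.code a n g))
  | .inter π π' => Nat.pair 7 (Nat.pair (π.code a n g) (π'.code a n g))
  | .conv π => Nat.pair 8 (π.code a n g)
  | .test φ => Nat.pair 9 (φ.code a n g)

/-- A numerical code of a formula, given codes of atoms, nominals and agents. -/
def Formula.code (a : Atm → ℕ) (n : Nom → ℕ) (g : Agt → ℕ) : Formula Atm Nom Agt → ℕ
  | .atom p => Nat.pair 0 (a p)
  | .nom x => Nat.pair 1 (n x)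
  | .neg φ => Nat.pair 2 (φ.code a n g)
  | .and φ ψ => Nat.pair 3 (Nat.pair (φ.code a n g) (ψ.code a n g))
  | .box π φ => Nat.pair 4 (Nat.pair (π.code a n g) (φ.code a n g))
end

section

variable {a : Atm → ℕ} {n : Nom → ℕ} {g : Agt → ℕ}

mutual
theorem Program.code_inj (ha : a.Injective) (hn : n.Injective) (hg : g.Injective) :
    ∀ π ρ : Program Atm Nom Agt, π.code a n g = ρ.code a n g → π = ρ
  | .know i, ρ => by
    rcases ρ with _ | ⟨_, _ | _⟩ | ⟨_, _ | _⟩ | _ | _ | _ | _ | _ <;>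
      simp [Program.code, Nat.pair_eq_pair, hg.eq_iff]
  | .le i τ, ρ => by
    rcases τ <;> rcases ρ with _ | ⟨_, _ | _⟩ | ⟨_, _ | _⟩ | _ | _ | _ | _ | _ <;>
      simp [Program.code, Nat.pair_eq_pair, hg.eq_iff]
  | .nle i τ, ρ => by
    rcases τ <;> rcases ρ with _ | ⟨_, _ | _⟩ | ⟨_, _ | _⟩ | _ | _ | _ | _ | _ <;>
      simp [Program.code, Nat.pair_eq_pair, hg.eq_iff]
  | .seq π π', ρ => by
    have h := Program.code_inj ha hn hg π
    have h' := Program.code_inj ha hn hg π'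
    rcases ρ with _ | ⟨_, _ | _⟩ | ⟨_, _ | _⟩ | _ | _ | _ | _ | _ <;>
      simp [Program.code, Nat.pair_eq_pair]
    exact fun e e' => ⟨h _ e, h' _ e'⟩
  | .union π π', ρ => by
    have h := Program.code_inj ha hn hg π
    have h' := Program.code_inj ha hn hg π'
    rcases ρ with _ | ⟨_, _ | _⟩ | ⟨_, _ | _⟩ | _ | _ | _ | _ | _ <;>
      simp [Program.code, Nat.pair_eq_pair]
    exact fun e e' => ⟨h _ e, h' _ e'⟩
  | .inter π π', ρ => by
    have h := Program.code_inj ha hn hg π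
    have h' := Program.code_inj ha hn hg π'
    rcases ρ with _ | ⟨_, _ | _⟩ | ⟨_, _ | _⟩ | _ | _ | _ | _ | _ <;>
      simp [Program.code, Nat.pair_eq_pair]
    exact fun e e' => ⟨h _ e, h' _ e'⟩
  | .conv π, ρ => by
    have h := Program.code_inj ha hn hg π
    rcases ρ with _ | ⟨_, _ | _⟩ | ⟨_, _ | _⟩ | _ | _ | _ | _ | _ <;>
      simp [Program.code, Nat.pair_eq_pair]
    exact h _
  | .test φ, ρ => by
    have h := Formula.code_inj ha hn hg φ
    rcases ρ with _ | ⟨_, _ | _⟩ | ⟨_, _ | _⟩ | _ | _ | _ | _ | _ <;>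
      simp [Program.code, Nat.pair_eq_pair]
    exact h _

theorem Formula.code_inj (ha : a.Injective) (hn : n.Injective) (hg : g.Injective) :
    ∀ φ ψ : Formula Atm Nom Agt, φ.code a n g = ψ.code a n g → φ = ψ
  | .atom p, ψ => by
    rcases ψ <;> simp [Formula.code, Nat.pair_eq_pair, ha.eq_iff]
  | .nom x, ψ => by
    rcases ψ <;> simp [Formula.code, Nat.pair_eq_pair, hn.eq_iff]
  | .neg φ, ψ => by
    have h := Formula.code_inj ha hn hg φ
    rcases ψ <;> simp [Formula.code, Nat.pair_eq_pair]
    exact h _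
  | .and φ φ', ψ => by
    have h := Formula.code_inj ha hn hg φ
    have h' := Formula.code_inj ha hn hg φ'
    rcases ψ <;> simp [Formula.code, Nat.pair_eq_pair]
    exact fun e e' => ⟨h _ e, h' _ e'⟩
  | .box π φ, ψ => by
    have h := Program.code_inj ha hn hg π
    have h' := Formula.code_inj ha hn hg φ
    rcases ψ <;> simp [Formula.code, Nat.pair_eq_pair]
    exact fun e e' => ⟨h _ e, h' _ e'⟩
end

end

instance Formula.instCountable [Countable Atm] [Countable Nom] [Countable Agt] :
    Countable (Formula Atm Nom Agt) := by
  obtain ⟨a, ha⟩ := exists_injective_nat Atm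
  obtain ⟨n, hn⟩ := exists_injective_nat Nom
  obtain ⟨g, hg⟩ := exists_injective_nat Agt
  exact ⟨Formula.code a n g, Formula.code_inj ha hn hg⟩

end Countability

section Reachable

variable {Atm : Type u₁} {Nom : Type u₂} {Agt : Type u₃}

/-! ### The worlds reachable from a maximal consistent set -/

/-- The theory of the world named `x` as seen from `S`. -/
def theoryAt (S : Set (Formula Atm Nom Agt)) (x : Nom) : Set (Formula Atm Nom Agt) :=
  {φ | ∃ π, π ⟐ (.nom x ⋏ φ) ∈ S}

variable {S : Set (Formula Atm Nom Agt)} {x : Nom} {π : Program Atm Nom Agt}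

/-- The theories of the worlds reachable from `S`, indexed by a type in any universe. -/
def reachable [Countable Nom] (S : Set (Formula Atm Nom Agt)) :
    Shrink.{u} (Set.range fun x : {x : Nom // ∃ π, π ⟐ .nom x ∈ S} => theoryAt S x) →
      Set (Formula Atm Nom Agt) :=
  fun w => ((equivShrink _).symm w).1

theorem exists_reachable_eq [Countable Nom] (h : π ⟐ .nom x ∈ S) :
    ∃ w, reachable.{u₁, u₂, u₃, u} S w = theoryAt S x :=
  ⟨equivShrink _ ⟨_, ⟨x, π, h⟩, rfl⟩, by simp [reachable]⟩

theorem exists_eq_reachable [Countable Nom] (w) :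
    ∃ (x : Nom) (π : Program Atm Nom Agt), π ⟐ .nom x ∈ S ∧
      reachable.{u₁, u₂, u₃, u} S w = theoryAt S x := by
  obtain ⟨⟨x, π, h⟩, e⟩ := ((equivShrink _).symm w).2
  exact ⟨x, π, h, e.symm⟩

end Reachable

-- Derived rules and maximal consistent sets

section Derivations

variable {Atm : Type u₁} {Nom : Type u₂} {Agt : Type u₃} [Nonempty Atm]
  {π π' : Program Atm Nom Agt} {φ ψ χ : Formula Atm Nom Agt}

namespace Provable

theorem of_taut (t : IsTautology (φ ⇒ ψ)) (h : Provable φ) : Provable ψ :=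
  .mp _ _ (.taut _ t) h

theorem of_taut₂ (t : IsTautology (φ ⇒ ψ ⇒ χ)) (h : Provable φ) (h' : Provable ψ) :
    Provable χ :=
  .mp _ _ (of_taut t h) h'

theorem imp_trans (h : Provable (φ ⇒ ψ)) (h' : Provable (ψ ⇒ χ)) : Provable (φ ⇒ χ) :=
  of_taut₂ (fun v hn ha => by simp only [Formula.imp, hn, ha]; tauto) h h'

/-- A test prefixed to a program absorbs a hypothesis into the box, which gives Cov, a rule without
side formulas, access to hypotheses. -/
theorem imp_box_of_test (h : Provable (.seq (.test φ) π ⊡ ψ)) : Provable (φ ⇒ π ⊡ ψ) :=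
  have h₁ : Provable (.test φ ⊡ π ⊡ ψ) := of_taut₂
    (fun v hn ha => by simp only [Formula.iff, Formula.imp, hn, ha]; tauto)
    (.red_seq (.test φ) π ψ) h
  of_taut₂ (fun v hn ha => by simp only [Formula.iff, Formula.imp, hn, ha]; tauto)
    (.red_test φ (π ⊡ ψ)) h₁

theorem test_of_imp_box (h : Provable (φ ⇒ π ⊡ ψ)) : Provable (.seq (.test φ) π ⊡ ψ) :=
  have h₁ : Provable (.test φ ⊡ π ⊡ ψ) := of_taut₂
    (fun v hn ha => by simp only [Formula.iff, Formula.imp, hn, ha]; tauto)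
    (.red_test φ (π ⊡ ψ)) h
  of_taut₂ (fun v hn ha => by simp only [Formula.iff, Formula.imp, hn, ha]; tauto)
    (.red_seq (.test φ) π ψ) h₁

/-- The rule Cov relativized to a hypothesis. -/
theorem imp_cov (h : ∀ x, Provable (φ ⇒ π ⊡ ∼(.nom x))) : Provable (φ ⇒ π ⊡ .bot) :=
  imp_box_of_test (.cov _ fun x => test_of_imp_box (h x))

end Provable

/-- `S` is a maximal consistent set of formulas. -/
structure IsMCS (S : Set (Formula Atm Nom Agt)) : Prop where
  mem_of_provable : ∀ φ, Provable φ → φ ∈ S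
  mem_of_imp : ∀ φ ψ, (φ ⇒ ψ) ∈ S → φ ∈ S → ψ ∈ S
  neg_mem_iff : ∀ φ, ∼φ ∈ S ↔ φ ∉ S

namespace IsMCS

variable {S T : Set (Formula Atm Nom Agt)}

theorem mp (hS : IsMCS S) (h : Provable (φ ⇒ ψ)) (h' : φ ∈ S) : ψ ∈ S :=
  hS.mem_of_imp _ _ (hS.mem_of_provable _ h) h'

theorem taut (hS : IsMCS S) (t : IsTautology (φ ⇒ ψ)) (h : φ ∈ S) : ψ ∈ S :=
  hS.mp (.taut _ t) h

theorem and_mem_iff (hS : IsMCS S) : φ ⋏ ψ ∈ S ↔ φ ∈ S ∧ ψ ∈ S := by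
  refine ⟨fun h => ⟨hS.taut (fun v hn ha => ?_) h, hS.taut (fun v hn ha => ?_) h⟩, fun h =>
    hS.mem_of_imp _ _ (hS.taut (φ := φ) (ψ := ψ ⇒ φ ⋏ ψ) (fun v hn ha => ?_) h.1) h.2⟩ <;>
  · simp only [Formula.imp, hn, ha]; tauto

theorem imp_mem_iff (hS : IsMCS S) : (φ ⇒ ψ) ∈ S ↔ (φ ∈ S → ψ ∈ S) := by
  simp only [Formula.imp, hS.neg_mem_iff, hS.and_mem_iff]; tauto

theorem or_mem_iff (hS : IsMCS S) : φ ⋎ ψ ∈ S ↔ (φ ∈ S ∨ ψ ∈ S) := by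
  simp only [Formula.or, hS.neg_mem_iff, hS.and_mem_iff]; tauto

theorem iff_mem_iff (hS : IsMCS S) : (φ ⇔ ψ) ∈ S ↔ (φ ∈ S ↔ ψ ∈ S) := by
  simp only [Formula.iff, hS.imp_mem_iff, hS.and_mem_iff]; tauto

theorem bot_notMem (hS : IsMCS S) : Formula.bot ∉ S := by
  simp only [Formula.bot, hS.neg_mem_iff, hS.and_mem_iff]; tauto

theorem mem_iff_of_provable (hS : IsMCS S) (h : Provable (φ ⇔ ψ)) : φ ∈ S ↔ ψ ∈ S :=
  hS.iff_mem_iff.1 (hS.mem_of_provable _ h)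

theorem box_mono (hS : IsMCS S) (h : Provable (φ ⇒ ψ)) (h' : π ⊡ φ ∈ S) : π ⊡ ψ ∈ S :=
  hS.mp (.ax_k π φ ψ) (hS.and_mem_iff.2 ⟨h', hS.mem_of_provable _ (.nec π _ h)⟩)

theorem box_and (hS : IsMCS S) (h : π ⊡ φ ∈ S) (h' : π ⊡ ψ ∈ S) : π ⊡ (φ ⋏ ψ) ∈ S :=
  hS.mp (.ax_k π ψ _) (hS.and_mem_iff.2 ⟨h', hS.box_mono (φ := φ) (.taut _ fun v hn ha => by
    simp only [Formula.imp, hn, ha]; tauto) h⟩)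

theorem dia_mem_iff (hS : IsMCS S) : π ⟐ φ ∈ S ↔ π ⊡ ∼φ ∉ S := hS.neg_mem_iff _

theorem box_mem_iff (hS : IsMCS S) : π ⊡ φ ∈ S ↔ π ⟐ ∼φ ∉ S := by
  rw [hS.dia_mem_iff, not_not]
  constructor <;> exact hS.box_mono (.taut _ fun v hn ha => by
    simp only [Formula.imp, hn, ha]; tauto)

theorem dia_mono (hS : IsMCS S) (h : Provable (φ ⇒ ψ)) (h' : π ⟐ φ ∈ S) : π ⟐ ψ ∈ S := by
  rw [hS.dia_mem_iff] at *
  exact fun h'' => h' (hS.box_mono (.of_taut (fun v hn ha => by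
    simp only [Formula.imp, hn, ha]; tauto) h) h'')

theorem dia_mono_taut (hS : IsMCS S) (t : IsTautology (φ ⇒ ψ)) (h : π ⟐ φ ∈ S) :
    π ⟐ ψ ∈ S :=
  hS.dia_mono (.taut _ t) h

theorem dia_and_box (hS : IsMCS S) (h : π ⟐ φ ∈ S) (h' : π ⊡ ψ ∈ S) : π ⟐ (φ ⋏ ψ) ∈ S := by
  rw [hS.dia_mem_iff] at *
  exact fun h'' => h (hS.box_mono (.taut _ fun v hn ha => by
    simp only [Formula.imp, hn, ha]; tauto) (hS.box_and h' h''))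

theorem dia_seq_mem_iff (hS : IsMCS S) : .seq π π' ⟐ φ ∈ S ↔ π ⟐ π' ⟐ φ ∈ S := by
  rw [hS.dia_mem_iff, hS.mem_iff_of_provable (.red_seq π π' _), hS.box_mem_iff, not_not]
  exact Iff.rfl

theorem dia_test_mem_iff (hS : IsMCS S) : .test φ ⟐ ψ ∈ S ↔ φ ∈ S ∧ ψ ∈ S := by
  rw [hS.dia_mem_iff, hS.mem_iff_of_provable (.red_test φ _), hS.imp_mem_iff, hS.neg_mem_iff]
  tauto

theorem dia_seq_test_mem_iff (hS : IsMCS S) :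
    .seq π (.test φ) ⟐ ψ ∈ S ↔ π ⟐ (φ ⋏ ψ) ∈ S := by
  rw [hS.dia_seq_mem_iff]
  constructor <;> refine hS.dia_mono (.of_taut (fun v hn ha => ?_) (.red_test φ (∼ψ))) <;>
  · simp only [Formula.iff, Formula.dia, Formula.imp, hn, ha]; tauto

theorem eq_of_subset (hS : IsMCS S) (hT : IsMCS T) (h : S ⊆ T) : S = T := by
  refine h.antisymm fun φ hφ => by_contra fun h' => ?_
  exact (hT.neg_mem_iff φ).1 (h ((hS.neg_mem_iff φ).2 h')) hφ

end IsMCS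

/-! ### Lindenbaum's lemma -/

/-- One Lindenbaum step. Each stage is a single formula, so that `Provable.imp_cov` applies to it;
the last clause records a witness whenever a formula [π]⊥ is rejected. -/
theorem exists_consistent_extension (α ψ : Formula Atm Nom Agt) (hα : ¬ Provable (∼α)) :
    ∃ β, ¬ Provable (∼β) ∧ Provable (β ⇒ α) ∧ (Provable (β ⇒ ψ) ∨ Provable (β ⇒ ∼ψ)) ∧
      ∀ π, ψ = π ⊡ .bot → Provable (β ⇒ ψ) ∨ ∃ x, Provable (β ⇒ π ⟐ .nom x) := by
  by_cases h : Provable (∼(α ⋏ ψ))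
  · by_cases hπ : ∃ π, ψ = π ⊡ .bot
    · obtain ⟨π, rfl⟩ := hπ
      -- Otherwise relativized Cov proves α → [π]⊥, which with `h` refutes α.
      obtain ⟨x, hx⟩ : ∃ x, ¬ Provable (α ⇒ π ⊡ ∼(.nom x)) := by
        by_contra! hc
        exact hα (.of_taut₂ (fun v hn ha => by simp only [Formula.imp, hn, ha]; tauto) h
          (Provable.imp_cov hc))
      -- The negation of α ∧ ⟨π⟩x is by definition α → [π]¬x.
      refine ⟨α ⋏ π ⟐ .nom x, fun h' => hx h', .taut _ fun v hn ha => ?_, .inr ?_, ?_⟩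
      · simp only [Formula.imp, hn, ha]; tauto
      · exact .of_taut (fun v hn ha => by simp only [Formula.imp, hn, ha]; tauto) h
      · rintro ρ e
        injection e with e
        subst e
        exact .inr ⟨x, .taut _ fun v hn ha => by simp only [Formula.imp, hn, ha]; tauto⟩
    · refine ⟨α, hα, .taut _ fun v hn ha => ?_, .inr ?_, fun π e => (hπ ⟨π, e⟩).elim⟩
      · simp only [Formula.imp, hn, ha]; tauto
      · exact .of_taut (fun v hn ha => by simp only [Formula.imp, hn, ha]; tauto) h
  · have h' : Provable (α ⋏ ψ ⇒ ψ) :=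
      .taut _ fun v hn ha => by simp only [Formula.imp, hn, ha]; tauto
    refine ⟨α ⋏ ψ, h, .taut _ fun v hn ha => ?_, .inl h', fun _ _ => .inl h'⟩
    simp only [Formula.imp, hn, ha]; tauto

/-- A consistent formula lies in a maximal consistent set that is closed under Cov. -/
theorem exists_isMCS [Countable (Formula Atm Nom Agt)] (α : Formula Atm Nom Agt)
    (hα : ¬ Provable (∼α)) :
    ∃ S : Set (Formula Atm Nom Agt), IsMCS S ∧ α ∈ S ∧
      ∀ π, π ⊡ .bot ∈ S ∨ ∃ x, π ⟐ .nom x ∈ S := by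
  have : Nonempty (Formula Atm Nom Agt) := ⟨α⟩
  obtain ⟨e, he⟩ := exists_surjective_nat (Formula Atm Nom Agt)
  choose next hcon hle hdec hcov using
    fun (α : {α : Formula Atm Nom Agt // ¬ Provable (∼α)}) ψ =>
      exists_consistent_extension α.1 ψ α.2
  let s : ℕ → {α : Formula Atm Nom Agt // ¬ Provable (∼α)} :=
    Nat.rec ⟨α, hα⟩ fun n β => ⟨next β (e n), hcon β (e n)⟩
  have hs : ∀ m n, m ≤ n → Provable ((s n).1 ⇒ (s m).1) := by
    intro m n h
    induction h with
    | refl => exact .taut _ fun v hn ha => by simp only [Formula.imp, hn, ha]; tauto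
    | step _ ih => exact (hle _ _).imp_trans ih
  have hdir : ∀ {φ m n}, m ≤ n → Provable ((s m).1 ⇒ φ) → Provable ((s n).1 ⇒ φ) :=
    fun h h' => (hs _ _ h).imp_trans h'
  have hnot : ∀ {φ m n}, Provable ((s m).1 ⇒ φ) → Provable ((s n).1 ⇒ ∼φ) → False := by
    intro φ m n h h'
    refine (s (max m n)).2 (.of_taut₂ (fun v hn ha => ?_) (hdir (le_max_left m n) h)
      (hdir (le_max_right m n) h'))
    simp only [Formula.imp, hn, ha]; tauto
  refine ⟨{φ | ∃ n, Provable ((s n).1 ⇒ φ)}, ⟨?_, ?_, ?_⟩, ⟨0, ?_⟩, ?_⟩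
  · exact fun φ h => ⟨0, .of_taut (fun v hn ha => by simp only [Formula.imp, hn, ha]; tauto) h⟩
  · rintro φ ψ ⟨m, hm⟩ ⟨n, hn⟩
    refine ⟨max m n, .of_taut₂ (fun v hn ha => ?_) (hdir (le_max_left m n) hm)
      (hdir (le_max_right m n) hn)⟩
    simp only [Formula.imp, hn, ha]; tauto
  · refine fun φ => ⟨fun ⟨n, hn⟩ ⟨m, hm⟩ => hnot hm hn, fun h => ?_⟩
    obtain ⟨n, rfl⟩ := he φ
    exact ⟨n + 1, (hdec (s n) (e n)).resolve_left fun h' => h ⟨n + 1, h'⟩⟩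
  · exact hs 0 0 le_rfl
  · intro π
    obtain ⟨n, hn⟩ := he (π ⊡ .bot)
    rcases hcov (s n) (e n) π hn with h | ⟨x, h⟩
    · exact .inl ⟨n + 1, hn ▸ h⟩
    · exact .inr ⟨x, n + 1, h⟩

/-! ### The canonical model -/

/-- A family of maximal consistent sets in which every world is named, names are unique, and
every diamond has a named witness. -/
structure IsNamedFamily {W : Type u} (th : W → Set (Formula Atm Nom Agt)) : Prop where
  isMCS : ∀ w, IsMCS (th w)
  named : ∀ w, ∃ x, .nom x ∈ th w
  eq_of_nom : ∀ w v x, .nom x ∈ th w → .nom x ∈ th v → w = v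
  exists_witness : ∀ w π φ, π ⟐ φ ∈ th w →
    ∃ v x, .nom x ∈ th v ∧ φ ∈ th v ∧ π ⟐ .nom x ∈ th w

/-- The canonical accessibility relation of a program. -/
def CanRel {W : Type u} (th : W → Set (Formula Atm Nom Agt)) (π : Program Atm Nom Agt)
    (w v : W) : Prop :=
  ∀ φ, π ⊡ φ ∈ th w → φ ∈ th v

/-- The canonical structure on a family of sets of formulas. -/
def canonical {W : Type u} (th : W → Set (Formula Atm Nom Agt)) :
    CogStructure.{u₁, u₂, u₃, u} Atm Nom Agt where
  World := W
  le i τ := CanRel th (.le i τ)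
  know i := CanRel th (.know i)
  V w := {a | a.elim Formula.atom Formula.nom ∈ th w}

namespace IsNamedFamily

variable {W : Type u} {th : W → Set (Formula Atm Nom Agt)} {w v : W} {x : Nom}

theorem dia_mem (H : IsNamedFamily th) (r : CanRel th π w v) (h : φ ∈ th v) : π ⟐ φ ∈ th w := by
  rw [(H.isMCS w).dia_mem_iff]
  exact fun h' => ((H.isMCS v).neg_mem_iff φ).1 (r _ h') h

theorem mem_of_dia_and (H : IsNamedFamily th) (hx : .nom x ∈ th v)
    (h : π ⟐ (.nom x ⋏ φ) ∈ th w) : φ ∈ th v := by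
  obtain ⟨u, y, -, hu, -⟩ := H.exists_witness _ _ _ h
  rw [(H.isMCS u).and_mem_iff] at hu
  obtain rfl := H.eq_of_nom u v x hu.1 hx
  exact hu.2

/-- Any witness of ⟨π⟩(x ∧ φ) must be v, the only world named x; so the single formula ⟨π⟩x already
forces every φ with [π]φ ∈ w into v. -/
theorem canRel_iff (H : IsNamedFamily th) (hx : .nom x ∈ th v) :
    CanRel th π w v ↔ π ⟐ .nom x ∈ th w :=
  ⟨fun r => H.dia_mem r hx,
    fun h _ h' => H.mem_of_dia_and hx ((H.isMCS w).dia_and_box h h')⟩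

theorem exists_canRel (H : IsNamedFamily th) (h : π ⟐ φ ∈ th w) :
    ∃ v, CanRel th π w v ∧ φ ∈ th v := by
  obtain ⟨v, x, hx, hv, h⟩ := H.exists_witness _ _ _ h
  exact ⟨v, (H.canRel_iff hx).2 h, hv⟩

/-- With x a name of v, `comp1` at ¬x says that ⟨≡⟩x splits into ⟨⪯⟩x or ⟨⪯^∼⟩x, and `comp2` that
the two exclude each other. -/
theorem canRel_nle (H : IsNamedFamily th) (i : Agt) (τ : Attitude) :
    CanRel th (.nle i τ) w v ↔ CanRel th (.know i) w v ∧ ¬ CanRel th (.le i τ) w v := by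
  obtain ⟨x, hx⟩ := H.named v
  have h₁ := (H.isMCS w).mem_iff_of_provable (.comp1 i τ (∼(.nom x)))
  have h₂ := (H.isMCS w).imp_mem_iff.1 ((H.isMCS w).mem_of_provable _ (.comp2 i τ x))
  rw [(H.isMCS w).and_mem_iff] at h₁
  rw [(H.isMCS w).dia_mem_iff] at h₂
  simp only [H.canRel_iff hx, (H.isMCS w).dia_mem_iff]
  tauto

theorem canRel_seq (H : IsNamedFamily th) :
    CanRel th (.seq π π') w v ↔ ∃ u, CanRel th π w u ∧ CanRel th π' u v := by
  obtain ⟨x, hx⟩ := H.named v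
  simp only [H.canRel_iff hx, (H.isMCS w).dia_seq_mem_iff]
  exact ⟨H.exists_canRel, fun ⟨u, r, h⟩ => H.dia_mem r h⟩

theorem canRel_union (H : IsNamedFamily th) :
    CanRel th (.union π π') w v ↔ CanRel th π w v ∨ CanRel th π' w v := by
  obtain ⟨x, hx⟩ := H.named v
  have h := (H.isMCS w).mem_iff_of_provable (.red_union π π' (∼(.nom x)))
  rw [(H.isMCS w).and_mem_iff] at h
  simp only [H.canRel_iff hx, (H.isMCS w).dia_mem_iff]
  tauto

theorem canRel_inter (H : IsNamedFamily th) :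
    CanRel th (.inter π π') w v ↔ CanRel th π w v ∧ CanRel th π' w v := by
  obtain ⟨x, hx⟩ := H.named v
  refine ⟨fun r => ⟨fun φ h => ?_, fun φ h => ?_⟩, ?_⟩
  -- φ → φ serves as ⊤ for the other component of `add1_inter`.
  · have ht : π' ⊡ (φ ⇒ φ) ∈ th w := (H.isMCS w).mem_of_provable _ (.nec _ _ (.taut _
      fun v hn ha => by simp only [Formula.imp, hn, ha]; tauto))
    exact ((H.isMCS v).and_mem_iff.1 (r _ ((H.isMCS w).mp (.add1_inter π π' _ _)
      ((H.isMCS w).and_mem_iff.2 ⟨h, ht⟩)))).1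
  · have ht : π ⊡ (φ ⇒ φ) ∈ th w := (H.isMCS w).mem_of_provable _ (.nec _ _ (.taut _
      fun v hn ha => by simp only [Formula.imp, hn, ha]; tauto))
    exact ((H.isMCS v).and_mem_iff.1 (r _ ((H.isMCS w).mp (.add1_inter π π' _ _)
      ((H.isMCS w).and_mem_iff.2 ⟨ht, h⟩)))).2
  · simp only [H.canRel_iff hx]
    exact fun h => (H.isMCS w).mp (.add2_inter π π' x) ((H.isMCS w).and_mem_iff.2 h)

theorem canRel_conv (H : IsNamedFamily th) :
    CanRel th (.conv π) w v ↔ CanRel th π v w := by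
  constructor
  · intro r φ h
    by_contra h'
    rw [← (H.isMCS w).neg_mem_iff] at h'
    have := r _ ((H.isMCS w).mp (.conv2 π _) h')
    exact (H.isMCS v).box_mem_iff.1 h this
  · intro r φ h
    by_contra h'
    rw [← (H.isMCS v).neg_mem_iff] at h'
    have := r _ ((H.isMCS v).mp (.conv1 π _) h')
    exact (H.isMCS w).box_mem_iff.1 h this

theorem canRel_test (H : IsNamedFamily th) :
    CanRel th (.test φ) w v ↔ w = v ∧ φ ∈ th w := by
  obtain ⟨x, hx⟩ := H.named v
  rw [H.canRel_iff hx, (H.isMCS w).dia_test_mem_iff]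
  exact ⟨fun h => ⟨H.eq_of_nom w v x h.2 hx, h.1⟩, fun h => ⟨h.2, h.1 ▸ hx⟩⟩

mutual
-- Tests put formulas inside programs and boxes put programs inside formulas, hence the simultaneous
-- induction with the truth lemma.
theorem rel_iff (H : IsNamedFamily th) :
    ∀ (π : Program Atm Nom Agt) (w v : (canonical th).World), (canonical th).Rel π w v ↔ CanRel th π w v
  | .know _, _, _ => by rw [CogStructure.Rel]; exact Iff.rfl
  | .le _ _, _, _ => by rw [CogStructure.Rel]; exact Iff.rfl
  | .nle i τ, w, v => by rw [CogStructure.Rel]; exact (H.canRel_nle i τ).symm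
  | .seq π π', w, v => by
    rw [CogStructure.Rel]
    exact (exists_congr fun u => and_congr (rel_iff H π w u) (rel_iff H π' u v)).trans
      H.canRel_seq.symm
  | .union π π', w, v => by
    rw [CogStructure.Rel]
    exact (or_congr (rel_iff H π w v) (rel_iff H π' w v)).trans H.canRel_union.symm
  | .inter π π', w, v => by
    rw [CogStructure.Rel]
    exact (and_congr (rel_iff H π w v) (rel_iff H π' w v)).trans H.canRel_inter.symm
  | .conv π, w, v => by rw [CogStructure.Rel]; exact (rel_iff H π v w).trans H.canRel_conv.symm
  | .test φ, w, v => by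
    rw [CogStructure.Rel]
    exact (and_congr_right' (sat_iff H φ w)).trans H.canRel_test.symm

/-- The truth lemma. -/
theorem sat_iff (H : IsNamedFamily th) :
    ∀ (φ : Formula Atm Nom Agt) (w : (canonical th).World), (canonical th).Sat φ w ↔ φ ∈ th w
  | .atom p, w => by rw [CogStructure.Sat]; exact Iff.rfl
  | .nom x, w => by rw [CogStructure.Sat]; exact Iff.rfl
  | .neg φ, w => by rw [CogStructure.Sat, sat_iff H φ, (H.isMCS w).neg_mem_iff]
  | .and φ ψ, w => by
    rw [CogStructure.Sat, sat_iff H φ, sat_iff H ψ, (H.isMCS w).and_mem_iff]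
  | .box π φ, w => by
    rw [CogStructure.Sat]
    refine ⟨fun h => by_contra fun h' => ?_,
      fun h v r => (sat_iff H φ v).2 ((rel_iff H π w v).1 r φ h)⟩
    rw [(H.isMCS w).box_mem_iff, not_not] at h'
    obtain ⟨v, r, hv⟩ := H.exists_canRel h'
    exact ((H.isMCS v).neg_mem_iff φ).1 hv
      ((sat_iff H φ v).1 (h v ((rel_iff H π w v).2 r)))
end

theorem isMCM (H : IsNamedFamily th) : (canonical th).IsMCM where
  le_preorder i τ :=
    { refl := fun w φ h => (H.isMCS w).mp (.t_le i τ φ) h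
      trans := fun w v u r s φ h => s _ (r _ ((H.isMCS w).mp (.four_le i τ φ) h)) }
  know_equivalence i :=
    { refl := fun w φ h => (H.isMCS w).mp (.t_know i φ) h
      symm := fun {w v} r φ h => by
        by_contra h'
        have h₁ : .know i ⊡ φ ∉ th w := fun h₂ => h' ((H.isMCS w).mp (.t_know i φ) h₂)
        rw [← (H.isMCS w).neg_mem_iff] at h₁
        exact ((H.isMCS v).neg_mem_iff _).1 (r _ ((H.isMCS w).mp (.five_know i φ) h₁)) h
      trans := fun {w v u} r s φ h => s _ (r _ ((H.isMCS w).mp (.four_know i φ) h)) }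
  c1 i τ w v r φ h := r φ ((H.isMCS w).mp (.inc i τ φ) h)
  c2 i τ w v r := by
    obtain ⟨x, hx⟩ := H.named w
    obtain ⟨y, hy⟩ := H.named v
    have r' : CanRel th (.know i) w w := fun φ h => (H.isMCS w).mp (.t_know i φ) h
    -- Connectedness is applied to names of w and v, so each disjunct speaks about exactly these two
    -- worlds.
    have h := (H.isMCS w).mp (.conn i τ (.nom x) (.nom y))
      ((H.isMCS w).and_mem_iff.2 ⟨H.dia_mem r' hx, H.dia_mem r hy⟩)
    rw [(H.isMCS w).or_mem_iff] at h
    exact h.imp (fun h => (H.canRel_iff hy).2 (H.mem_of_dia_and hx h))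
      (fun h => (H.canRel_iff hx).2 (H.mem_of_dia_and hy h))
  c3 w := Set.nonempty_iff_ne_empty.1 (H.named w)
  c4 w v h := by
    obtain ⟨x, hw, hv⟩ := Set.nonempty_iff_ne_empty.2 h
    exact H.eq_of_nom w v x hw hv

end IsNamedFamily

-- The worlds named from one maximal consistent set

section TheoryAt

variable {S : Set (Formula Atm Nom Agt)} {x y : Nom}

/-- By `most`, a fact about x seen through one program holds of x through every other; this makes
the theory at x coherent. -/
theorem IsMCS.dia_of_mem_theoryAt (hS : IsMCS S) (h : φ ∈ theoryAt S x)
    (h' : π ⟐ (.nom x ⋏ ψ) ∈ S) : π ⟐ (.nom x ⋏ φ ⋏ ψ) ∈ S := by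
  obtain ⟨ρ, h⟩ := h
  refine hS.dia_mono_taut (fun v hn ha => ?_)
    (hS.dia_and_box h' (hS.mp (.most ρ π x φ) h))
  simp only [Formula.imp, hn, ha]; tauto

theorem IsMCS.theoryAt_isMCS (hS : IsMCS S) (h : π ⟐ .nom x ∈ S) : IsMCS (theoryAt S x) := by
  refine ⟨fun φ hφ => ⟨π, hS.dia_and_box h (hS.mem_of_provable _ (.nec π _ hφ))⟩, ?_, ?_⟩
  · rintro φ ψ h₁ ⟨ρ, h₂⟩
    refine ⟨ρ, hS.dia_mono_taut (fun v hn ha => ?_) (hS.dia_of_mem_theoryAt h₁ h₂)⟩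
    simp only [Formula.imp, hn, ha]; tauto
  · refine fun φ => ⟨?_, fun h' => ⟨π, ?_⟩⟩
    · rintro ⟨ρ, h₁⟩ h₂
      have := hS.dia_of_mem_theoryAt h₂ h₁
      refine hS.dia_mem_iff.1 this (hS.mem_of_provable _ (.nec _ _ (.taut _ fun v hn ha => ?_)))
      simp only [hn, ha]; tauto
    · by_contra h''
      refine h' ⟨π, ?_⟩
      rw [hS.dia_mem_iff, not_not] at h''
      refine hS.dia_mono_taut (fun v hn ha => ?_) (hS.dia_and_box h h'')
      simp only [Formula.imp, hn, ha]; tauto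

/-- Some ⟨ρ⟩(y ∧ x) lies in S, and through ρ every fact about y becomes one about x; maximality then
turns inclusion into equality. -/
theorem IsMCS.theoryAt_eq (hS : IsMCS S) (hx : π ⟐ .nom x ∈ S) (h : .nom y ∈ theoryAt S x) :
    theoryAt S y = theoryAt S x := by
  have ⟨ρ, hρ⟩ := h
  have hρ' : ρ ⟐ (.nom y ⋏ .nom x) ∈ S := hS.dia_mono_taut (fun v hn ha => by
    simp only [Formula.imp, hn, ha]; tauto) hρ
  have hy : ρ ⟐ .nom y ∈ S := hS.dia_mono_taut (fun v hn ha => by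
    simp only [Formula.imp, hn, ha]; tauto) hρ
  refine (hS.theoryAt_isMCS hy).eq_of_subset (hS.theoryAt_isMCS hx) fun φ hφ => ⟨ρ, ?_⟩
  refine hS.dia_mono_taut (fun v hn ha => ?_) (hS.dia_of_mem_theoryAt hφ hρ')
  simp only [Formula.imp, hn, ha]; tauto

theorem IsMCS.nom_mem_theoryAt (hS : IsMCS S) (h : π ⟐ .nom x ∈ S) :
    .nom x ∈ theoryAt S x :=
  ⟨π, hS.dia_mono_taut (fun v hn ha => by simp only [Formula.imp, hn, ha]; tauto) h⟩

theorem IsMCS.exists_witness_theoryAt (hS : IsMCS S)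
    (hcov : ∀ π, π ⊡ .bot ∈ S ∨ ∃ x, π ⟐ .nom x ∈ S) (h : π ⟐ φ ∈ theoryAt S x) :
    ∃ y, (∃ ρ, ρ ⟐ .nom y ∈ S) ∧ φ ∈ theoryAt S y ∧ π ⟐ .nom y ∈ theoryAt S x := by
  obtain ⟨ρ, h⟩ := h
  -- σ reaches from S the π-successors of the world named x, so closure of S under Cov names them
  -- without any closure assumption on that world.
  let σ : Program Atm Nom Agt := .seq (.seq ρ (.test (.nom x))) π
  have hσ : ∀ {ψ}, σ ⟐ ψ ∈ S ↔ ρ ⟐ (.nom x ⋏ π ⟐ ψ) ∈ S :=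
    hS.dia_seq_mem_iff.trans hS.dia_seq_test_mem_iff
  rcases hcov (.seq σ (.test φ)) with hb | ⟨y, hy⟩
  · have ht : .seq σ (.test φ) ⟐ ∼.bot ∈ S := hS.dia_seq_test_mem_iff.2
      (hS.dia_mono_taut (fun v hn ha => by
        simp only [Formula.imp, Formula.bot, hn, ha]; tauto) (hσ.2 h))
    exact (hS.dia_mem_iff.1 ht (hS.box_mono (.taut _ fun v hn ha => by
      simp only [Formula.imp, hn, ha]; tauto) hb)).elim
  · rw [hS.dia_seq_test_mem_iff] at hy
    have hy' : σ ⟐ .nom y ∈ S := hS.dia_mono_taut (fun v hn ha => by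
      simp only [Formula.imp, hn, ha]; tauto) hy
    exact ⟨y, ⟨σ, hy'⟩, ⟨σ, hS.dia_mono_taut (fun v hn ha => by
      simp only [Formula.imp, hn, ha]; tauto) hy⟩, ρ, hσ.1 hy'⟩

theorem IsMCS.isNamedFamily_reachable [Countable Nom] (hS : IsMCS S)
    (hcov : ∀ π, π ⊡ .bot ∈ S ∨ ∃ x, π ⟐ .nom x ∈ S) :
    IsNamedFamily (reachable.{u₁, u₂, u₃, u} S) where
  isMCS w := by
    obtain ⟨x, π, h, e⟩ := exists_eq_reachable w
    exact e ▸ hS.theoryAt_isMCS h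
  named w := by
    obtain ⟨x, π, h, e⟩ := exists_eq_reachable w
    exact ⟨x, e ▸ hS.nom_mem_theoryAt h⟩
  eq_of_nom w v z hw hv := by
    obtain ⟨x, π, hx, ex⟩ := exists_eq_reachable w
    obtain ⟨y, ρ, hy, ey⟩ := exists_eq_reachable v
    rw [ex] at hw
    rw [ey] at hv
    have : reachable S w = reachable S v :=
      ex.trans ((hS.theoryAt_eq hx hw).symm.trans ((hS.theoryAt_eq hy hv).trans ey.symm))
    -- Worlds are indexed by theories and not by nominals, so two names of the same theory give one
    -- world.
    exact (equivShrink _).symm.injective (Subtype.ext this)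
  exists_witness w π φ h := by
    obtain ⟨x, ρ, hx, ex⟩ := exists_eq_reachable w
    rw [ex] at h
    obtain ⟨y, ⟨σ, hσ⟩, hφ, hy⟩ := hS.exists_witness_theoryAt hcov h
    obtain ⟨v, ev⟩ := exists_reachable_eq.{u₁, u₂, u₃, u} hσ
    exact ⟨v, y, ev ▸ hS.nom_mem_theoryAt hσ, ev ▸ hφ, ex ▸ hy⟩

/-- The test of ¬⊥ acts as the identity program, so Cov-closure for it provides a nominal in S
itself. -/
theorem IsMCS.exists_subset_reachable [Countable Nom] (hS : IsMCS S)
    (hcov : ∀ π, π ⊡ .bot ∈ S ∨ ∃ x, π ⟐ .nom x ∈ S) :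
    ∃ w, S ⊆ reachable.{u₁, u₂, u₃, u} S w := by
  have ht : ∼.bot ∈ S := (hS.neg_mem_iff _).2 hS.bot_notMem
  have htest : ∀ {φ}, .test (∼.bot) ⟐ φ ∈ S ↔ φ ∈ S := by
    intro φ
    rw [hS.dia_test_mem_iff]
    exact and_iff_right ht
  rcases hcov (.test (∼.bot)) with h | ⟨x, hx⟩
  · rw [hS.mem_iff_of_provable (.red_test _ _), hS.imp_mem_iff] at h
    exact (hS.bot_notMem (h ht)).elim
  · obtain ⟨w, hw⟩ := exists_reachable_eq.{u₁, u₂, u₃, u} hx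
    exact ⟨w, fun φ hφ => hw ▸ ⟨_, htest.2 (hS.and_mem_iff.2 ⟨htest.1 hx, hφ⟩)⟩⟩

end TheoryAt

/-- Every valid formula is a theorem of DLCA. -/
theorem Valid.provable [Countable Atm] [Countable Nom] [Countable Agt]
    (h : Valid.{u₁, u₂, u₃, u} φ) : Provable φ := by
  by_contra hφ
  obtain ⟨S, hS, hneg, hcov⟩ := exists_isMCS (∼φ) fun h' =>
    hφ (.of_taut (fun v hn ha => by simp only [Formula.imp, hn, ha]; tauto) h')
  have H := hS.isNamedFamily_reachable.{u₁, u₂, u₃, u} hcov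
  obtain ⟨w, hw⟩ := hS.exists_subset_reachable.{u₁, u₂, u₃, u} hcov
  exact ((H.isMCS w).neg_mem_iff φ).1 (hw hneg) ((H.sat_iff φ w).1 (h _ H.isMCM w))

end Derivations

end DLCA

theorem mainTheorem1
    {Atm : Type u₁} {Nom : Type u₂} {Agt : Type u₃}
    [Countable Atm] [Infinite Atm] [Countable Nom] [Infinite Nom] [Finite Agt]
    (φ : DLCA.Formula Atm Nom Agt) :
    DLCA.Provable φ ↔ DLCA.Valid.{u₁, u₂, u₃, u} φ :=
  ⟨DLCA.Provable.valid, DLCA.Valid.provable⟩
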